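/- Let $S_1,S_2$ be finite or countably infinite sets. For $i=1,2$ let $X_i$ be a nonexplosive (time-homogeneous, continuous-time) Markov process in $S_i$ with rate matrix $Q_i$, that is, $Q_i(x,y)\ge 0$ for $x\ne y$ and $Q_i(x,x)=-\sum_{y\ne x}Q_i(x,y)$; write $X_i(x,t)$ for its value at time $t$ when started at $x$, and $q_i(x)=-Q_i(x,x)$. Assume that $X_1$ and $X_2$ have locally bounded jumps: $\{y: Q_i(x,y)>0\}$ is finite for every $x\in S_i$. Let $(S_{i,n})_{n\ge 0}$ be a truncation sequence for $Q_i$, that is, an increasing sequence of finite sets with $\bigcup_n S_{i,n}=S_i$ and $\{y:Q_i(x,y)>0\}\subset S_{i,n+1}$ for all $x\in S_{i,n}$. A relation is a subset $R\subset S_1\times S_2$; it is nontrivial if $R\neq\emptyset$. Probability vectors $\mu$ on $S_1$ and $\nu$ on $S_2$ are stochastically related with respect to $R$, written $(\mu,\nu)\in R_{\mathrm{st}}$, if there is a probability vector $\lambda$ on $S_1\times S_2$ with marginals $\mu$ and $\nu$ such that $\sum_{(x,y)\in R}\lambda(x,y)=1$. The pair $X_1,X_2$ stochastically preserves $R$ if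 for all $(x_1,x_2)\in R$ and $t\ge0$ the distributions of $X_1(x_1,t)$ and $X_2(x_2,t)$ are stochastically related with respect to $R$. Define $$M(R)=\{(x,y)\in R:(\mu_{x,y},\nu_{x,y})\in R_{\mathrm{st}}\},$$ $$\mu_{x,y}(u)=\frac{Q_1(x,u)}{q_{x,y}}+\delta_x(u),\qquad \nu_{x,y}(v)=\frac{Q_2(y,v)}{q_{x,y}}+\delta_y(v),\qquad q_{x,y}=1+q_1(x)+q_2(y),$$ and $M^0(R)=R$, $M^k(R)=M(M^{k-1}(R))$ for $k\ge 1$, $M^*(R)=\bigcap_{k\ge0}M^k(R)$, and $T_n(R)=R\cap(S_{1,n}\times S_{2,n})$. **Theorem.** Let $R\subset S_1\times S_2$. 1. For every $n$: if $T_n(M^k(R))=\emptyset$ for some $k$, then $T_n(M^*(R))=\emptyset$. 2. If for every $n$ there is some $k$ with $T_n(M^k(R))=\emptyset$, then $M^*(R)=\emptyset$, and $X_1$ and $X_2$ do not stochastically preserve any nontrivial subrelation of $R$. -/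

import Mathlib

open MeasureTheory Filter Topology Set
open scoped NNReal

noncomputable section

/-- `μ` is a probability vector on the countable space `S`. -/
def IsProbVector {S : Type*} (μ : S → ℝ) : Prop :=
  (∀ x, 0 ≤ μ x) ∧ HasSum μ 1

/-- `lam` is a coupling of the vectors `μ` and `ν`: a probability vector on the product space
with marginals `μ` and `ν`. -/
def IsCouplingOf {S₁ S₂ : Type*} (lam : S₁ × S₂ → ℝ) (μ : S₁ → ℝ) (ν : S₂ → ℝ) : Prop :=
  IsProbVector lam ∧
    (∀ x, HasSum (fun y => lam (x, y)) (μ x)) ∧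
    (∀ y, HasSum (fun x => lam (x, y)) (ν y))

/-- The stochastic relation `R_st` generated by the relation `R`: the pairs of probability vectors
that admit a coupling which gives total mass one to `R`. -/
def stochRel {S₁ S₂ : Type*} (R : Set (S₁ × S₂)) : Set ((S₁ → ℝ) × (S₂ → ℝ)) :=
  {p | IsProbVector p.1 ∧ IsProbVector p.2 ∧
    ∃ lam : S₁ × S₂ → ℝ, IsCouplingOf lam p.1 p.2 ∧ HasSum (fun z : R => lam z) 1}

/-- A rate matrix: nonnegative off the diagonal, `Q(x,x) = -∑_{y ≠ x} Q(x,y)` (a finite sum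
or a convergent series). -/
def IsRateMatrix {S : Type*} (Q : S → S → ℝ) : Prop :=
  (∀ x y, x ≠ y → 0 ≤ Q x y) ∧
    ∀ x, HasSum (fun y : {y : S // y ≠ x} => Q x y) (-Q x x)

/-- Locally bounded jumps: from each state only finitely many states are reachable in one jump. -/
def LocallyBoundedJumps {S : Type*} (Q : S → S → ℝ) : Prop :=
  ∀ x, {y | 0 < Q x y}.Finite

/-- The vector `u ↦ Q(x,u) / c + δ_x(u)`. -/
def jumpVector {S : Type*} (Q : S → S → ℝ) (c : ℝ) (x : S) : S → ℝ :=
  fun u => c⁻¹ * Q x u + Set.indicator {x} (fun _ => (1 : ℝ)) u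

/-- The normalising constant `q_{x,y} = 1 + q₁(x) + q₂(y)`, with `qᵢ(x) = -Qᵢ(x,x)`. -/
def totalRate {S₁ S₂ : Type*} (Q₁ : S₁ → S₁ → ℝ) (Q₂ : S₂ → S₂ → ℝ) (x : S₁) (y : S₂) : ℝ :=
  1 + (-Q₁ x x) + (-Q₂ y y)

/-- The relation-to-relation mapping `M = M_{Q₁,Q₂}`. -/
def subrelMap {S₁ S₂ : Type*} (Q₁ : S₁ → S₁ → ℝ) (Q₂ : S₂ → S₂ → ℝ) (R : Set (S₁ × S₂)) :
    Set (S₁ × S₂) :=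
  {p | p ∈ R ∧
    (jumpVector Q₁ (totalRate Q₁ Q₂ p.1 p.2) p.1,
      jumpVector Q₂ (totalRate Q₁ Q₂ p.1 p.2) p.2) ∈ stochRel R}

/-- The iterates: `M⁰(R) = R` and `Mᵏ(R) = M(Mᵏ⁻¹(R))`. -/
def subrelIter {S₁ S₂ : Type*} (Q₁ : S₁ → S₁ → ℝ) (Q₂ : S₂ → S₂ → ℝ) (R : Set (S₁ × S₂)) :
    ℕ → Set (S₁ × S₂)
  | 0 => R
  | k + 1 => subrelMap Q₁ Q₂ (subrelIter Q₁ Q₂ R k)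

/-- The limit relation `M*(R) = ⋂ₖ Mᵏ(R)`. -/
def subrelLimit {S₁ S₂ : Type*} (Q₁ : S₁ → S₁ → ℝ) (Q₂ : S₂ → S₂ → ℝ) (R : Set (S₁ × S₂)) :
    Set (S₁ × S₂) :=
  ⋂ k, subrelIter Q₁ Q₂ R k

/-- A truncation sequence for `Q`: an increasing sequence of finite sets exhausting `S`, such that
every jump from a state in the `n`-th set leads into the `(n+1)`-st set. -/
def IsTruncationSeq {S : Type*} (Q : S → S → ℝ) (A : ℕ → Finset S) : Prop :=
  Monotone A ∧ (⋃ n, (A n : Set S)) = Set.univ ∧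
    ∀ n, ∀ x ∈ A n, {y | 0 < Q x y} ⊆ (A (n + 1) : Set S)

/-- The truncation `T_n(R) = R ∩ (A₁ₙ × A₂ₙ)`. -/
def truncRel {S₁ S₂ : Type*} (A₁ : ℕ → Finset S₁) (A₂ : ℕ → Finset S₂) (n : ℕ)
    (R : Set (S₁ × S₂)) : Set (S₁ × S₂) :=
  R ∩ ((A₁ n : Set S₁) ×ˢ (A₂ n : Set S₂))

/-- A time-homogeneous continuous-time Markov process with values in the (countable, discrete)
space `S`, with right-continuous paths. `law x` is the distribution of the process started at `x`;
the past up to time `s` is the σ-algebra generated by the values at times `u ≤ s`. -/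
structure MarkovProcess (Ω S : Type*) [MeasurableSpace Ω] where
  law : S → Measure Ω
  val : ℝ≥0 → Ω → S
  isProb : ∀ x, IsProbabilityMeasure (law x)
  measurable_val : ∀ t, Measurable[_, (⊤ : MeasurableSpace S)] (val t)
  start : ∀ x, ∀ᵐ ω ∂(law x), val 0 ω = x
  markov : ∀ (x : S) (s t : ℝ≥0) (A : Set Ω),
    MeasurableSet[⨆ u ∈ Set.Iic s, MeasurableSpace.comap (val u) ⊤] A → ∀ y z : S,
      law x (A ∩ {ω | val s ω = y} ∩ {ω | val (s + t) ω = z}) =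
        law x (A ∩ {ω | val s ω = y}) * law y {ω | val t ω = z}
  rightCont : ∀ x, ∀ᵐ ω ∂(law x), ∀ t, ∀ᶠ s in 𝓝[≥] t, val s ω = val t ω

/-- The distribution of `X(x,t)`, the value at time `t` of the process started at `x`, viewed as
a vector indexed by the state space. -/
def MarkovProcess.dist {Ω S : Type*} [MeasurableSpace Ω] (X : MarkovProcess Ω S)
    (x : S) (t : ℝ≥0) : S → ℝ :=
  fun y => (X.law x).real {ω | X.val t ω = y}

/-- Nonexplosive: almost surely there are only finitely many jumps in each bounded time interval. -/
def MarkovProcess.Nonexplosive {Ω S : Type*} [MeasurableSpace Ω] (X : MarkovProcess Ω S) : Prop :=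
  ∀ x, ∀ᵐ ω ∂(X.law x), ∀ T : ℝ≥0,
    {t | t ≤ T ∧ ¬ ∀ᶠ s in 𝓝[<] t, X.val s ω = X.val t ω}.Finite

/-- `Q(x,y)` is the transition rate of `X` from `x` to `y`: the right derivative at time zero of
the transition probability equals `Q(x,y)`. -/
def MarkovProcess.HasRateMatrix {Ω S : Type*} [MeasurableSpace Ω] (X : MarkovProcess Ω S)
    (Q : S → S → ℝ) : Prop :=
  IsRateMatrix Q ∧
    ∀ x y, HasDerivWithinAt (fun t : ℝ => X.dist x t.toNNReal y) (Q x y) (Set.Ici 0) 0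

/-- The pair `X₁, X₂` stochastically preserves the relation `R`. -/
def StochPreserves {Ω₁ Ω₂ S₁ S₂ : Type*} [MeasurableSpace Ω₁] [MeasurableSpace Ω₂]
    (X₁ : MarkovProcess Ω₁ S₁) (X₂ : MarkovProcess Ω₂ S₂) (R : Set (S₁ × S₂)) : Prop :=
  ∀ x₁ x₂, (x₁, x₂) ∈ R → ∀ t : ℝ≥0, (X₁.dist x₁ t, X₂.dist x₂ t) ∈ stochRel R

end

/-! Call $R'$ invariant if $R'\subseteq M(R')$. As $M$ is monotone, every invariant $R'\subseteq R$
lies in all $M^k(R)$, hence in $M^*(R)$. The truncations exhaust $S_1\times S_2$, so $M^*(R)$ is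
empty once each of its truncations is. It remains to show that a stochastically preserved relation
is invariant (`StochPreserves.subset_subrelMap`).

For $(x,y)$ in such a relation, the time-$t$ laws have a coupling supported on it. Scaling their
deviations from $\delta_x,\delta_y$ by $1/(qt)$, with $q=q_{x,y}$, keeps the pair related for small
$t$, because enough of the coupling's mass sits at $(x,y)$ (`stochRel_affine`). As $t\downarrow0$
the scaled vectors tend to the jump vectors, and relatedness survives the limit
(`mem_stochRel_of_tendsto`). -/

section Couplings

variable {S₁ S₂ : Type*} {R : Set (S₁ × S₂)} {lam : S₁ × S₂ → ℝ} {μ : S₁ → ℝ} {ν : S₂ → ℝ}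

lemma hasSum_indicator_singleton {S : Type*} (a : S) :
    HasSum (fun u => Set.indicator {a} (fun _ => (1 : ℝ)) u) 1 := by
  simpa using hasSum_single a fun u hu =>
    Set.indicator_of_notMem (s := {a}) hu fun _ => (1 : ℝ)

lemma IsCouplingOf.swap (h : IsCouplingOf lam μ ν) :
    IsCouplingOf (fun z : S₂ × S₁ => lam z.swap) ν μ :=
  ⟨⟨fun z => h.1.1 z.swap, (Equiv.prodComm S₂ S₁).hasSum_iff.2 h.1.2⟩, h.2.2, h.2.1⟩

lemma IsCouplingOf.isProbVector_left (h : IsCouplingOf lam μ ν) : IsProbVector μ :=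
  ⟨fun x => (h.2.1 x).nonneg fun y => h.1.1 (x, y), h.1.2.prod_fiberwise h.2.1⟩

lemma IsCouplingOf.isProbVector_right (h : IsCouplingOf lam μ ν) : IsProbVector ν :=
  h.swap.isProbVector_left

lemma IsProbVector.le_one {S : Type*} {p : S → ℝ} (h : IsProbVector p) (x : S) : p x ≤ 1 :=
  le_hasSum h.2 x fun y _ => h.1 y

lemma mem_stochRel_iff :
    (μ, ν) ∈ stochRel R ↔ ∃ lam, IsCouplingOf lam μ ν ∧ ∀ z ∉ R, lam z = 0 := by
  constructor
  · rintro ⟨-, -, lam, h, hR⟩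
    refine ⟨lam, h, fun z hz => ?_⟩
    have h0 : HasSum (fun z => lam z - R.indicator lam z) (1 - 1) :=
      h.1.2.sub (hasSum_subtype_iff_indicator.1 hR)
    rw [sub_self, hasSum_zero_iff_of_nonneg
      (fun z => sub_nonneg.2 (Set.indicator_le_self' (fun z _ => h.1.1 z) z))] at h0
    simpa [hz] using congrFun h0 z
  · rintro ⟨lam, h, hR⟩
    refine ⟨h.isProbVector_left, h.isProbVector_right, lam, h, ?_⟩
    exact (hasSum_subtype_iff_of_support_subset
      (fun z hz => by_contra fun hzR => hz (hR z hzR))).2 h.1.2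

lemma IsCouplingOf.hasSum_indicator_fst (h : IsCouplingOf lam μ ν) (F : Finset S₁) :
    HasSum (fun z => (Prod.fst ⁻¹' (F : Set S₁)).indicator lam z) (∑ x ∈ F, μ x) := by
  classical
  have hx : ∀ x ∈ F, HasSum (fun z => (Prod.fst ⁻¹' {x}).indicator lam z) (μ x) := by
    intro x _
    refine ((Prod.mk_right_injective x).hasSum_iff ?_).1 ?_
    · rintro ⟨a, b⟩ hz
      refine Set.indicator_of_notMem (fun hab => hz ⟨b, ?_⟩) _
      rw [show a = x from hab]
    · refine (h.2.1 x).congr_fun ?_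
      intro y
      simp
  refine (hasSum_sum hx).congr_fun fun z => ?_
  simp [Set.indicator_apply]

/-- Integrate $1_F+1_G-1\le 1_{F\times G}$ against `lam`. On singletons this bounds the mass at a
point from below; on large sets it prevents loss of mass in limits. -/
lemma IsCouplingOf.add_sub_one_le (h : IsCouplingOf lam μ ν) (F : Finset S₁) (G : Finset S₂) :
    ∑ x ∈ F, μ x + ∑ y ∈ G, ν y - 1 ≤ ∑ z ∈ F ×ˢ G, lam z := by
  classical
  have hF := h.hasSum_indicator_fst F
  have hG : HasSum (fun z => (Prod.snd ⁻¹' (G : Set S₂)).indicator lam z) (∑ y ∈ G, ν y) :=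
    (Equiv.prodComm S₂ S₁).hasSum_iff.1 (h.swap.hasSum_indicator_fst G)
  have hFG : HasSum (fun z => ((F ×ˢ G : Finset (S₁ × S₂)) : Set (S₁ × S₂)).indicator lam z)
      (∑ z ∈ F ×ˢ G, lam z) :=
    hasSum_subtype_iff_indicator.1 ((F ×ˢ G).hasSum lam)
  refine hasSum_le (fun z => ?_) ((hF.add hG).sub h.1.2) hFG
  have := h.1.1 z
  by_cases h1 : z.1 ∈ F <;> by_cases h2 : z.2 ∈ G <;>
    simp [h1, h2, this]

/-- Moving mass towards, or away from, a point of `R` keeps a stochastically related pair related,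
as long as the mass removed from that point is available there in every coupling. -/
lemma stochRel_affine (h : (μ, ν) ∈ stochRel R) {x : S₁} {y : S₂} (hxy : (x, y) ∈ R) {s : ℝ}
    (hs : 0 ≤ s) (hs' : s * ((1 - μ x) + (1 - ν y)) ≤ 1) :
    (fun u => s * (μ u - Set.indicator {x} (fun _ => (1 : ℝ)) u)
        + Set.indicator {x} (fun _ => (1 : ℝ)) u,
      fun v => s * (ν v - Set.indicator {y} (fun _ => (1 : ℝ)) v)
        + Set.indicator {y} (fun _ => (1 : ℝ)) v) ∈ stochRel R := by
  classical
  obtain ⟨lam, hl, hR⟩ := mem_stochRel_iff.1 h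
  have hδ := hasSum_indicator_singleton (x, y)
  have hδ₁ (u : S₁) : HasSum (fun v => Set.indicator {(x, y)} (fun _ => (1 : ℝ)) (u, v))
      (Set.indicator {x} (fun _ => (1 : ℝ)) u) := by
    by_cases hu : u = x
    · simpa [Set.indicator_apply, hu] using hasSum_ite_eq y (1 : ℝ)
    · simp [hu]
  have hδ₂ (v : S₂) : HasSum (fun u => Set.indicator {(x, y)} (fun _ => (1 : ℝ)) (u, v))
      (Set.indicator {y} (fun _ => (1 : ℝ)) v) := by
    by_cases hv : v = y
    · simpa [Set.indicator_apply, hv] using hasSum_ite_eq x (1 : ℝ)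
    · simp [hv]
  refine mem_stochRel_iff.2 ⟨fun z => s * (lam z - Set.indicator {(x, y)} (fun _ => (1 : ℝ)) z)
    + Set.indicator {(x, y)} (fun _ => (1 : ℝ)) z, ⟨⟨fun z => ?_, ?_⟩, fun u => ?_, fun v => ?_⟩,
    fun z hz => ?_⟩
  · by_cases hz : z = (x, y)
    · subst hz
      -- Only at $(x,y)$ can the new weight be negative. There
      -- $1-\lambda(x,y)\le(1-\mu(x))+(1-\nu(y))$, so `hs'` bounds the mass removed by one.
      have := hl.add_sub_one_le {x} {y}
      simp only [Finset.sum_singleton, Finset.singleton_product_singleton] at this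
      have := mul_le_mul_of_nonneg_left this hs
      simp only [Set.mem_singleton_iff, Set.indicator_of_mem]
      linarith
    · simpa [hz] using mul_nonneg hs (hl.1.1 z)
  · simpa using ((hl.1.2.sub hδ).mul_left s).add hδ
  · exact (((hl.2.1 u).sub (hδ₁ u)).mul_left s).add (hδ₁ u)
  · exact (((hl.2.2 v).sub (hδ₂ v)).mul_left s).add (hδ₂ v)
  · have : z ≠ (x, y) := fun h => hz (h ▸ hxy)
    simp [this, hR z hz]

lemma stochRel_mono {R' : Set (S₁ × S₂)} (h : R ⊆ R') : stochRel R ⊆ stochRel R' := by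
  rintro ⟨μ, ν⟩ hp
  obtain ⟨lam, hl, hR⟩ := mem_stochRel_iff.1 hp
  exact mem_stochRel_iff.2 ⟨lam, hl, fun z hz => hR z fun hz' => hz (h hz')⟩

lemma eq_of_le_of_hasSum {S : Type*} {a b : S → ℝ} {c : ℝ} (hab : ∀ x, a x ≤ b x)
    (ha : HasSum a c) (hb : HasSum b c) : a = b := by
  have h0 := hb.sub ha
  rw [sub_self, hasSum_zero_iff_of_nonneg (fun x => sub_nonneg.2 (hab x))] at h0
  exact funext fun x => (sub_eq_zero.1 (congrFun h0 x)).symm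

/-- A nonnegative vector of mass one whose finite row and column sums are dominated by `μ` and `ν`
is a coupling of `μ` and `ν`. -/
lemma isCouplingOf_of_sum_le (hlam : IsProbVector lam) (hμ : HasSum μ 1) (hν : HasSum ν 1)
    (h₁ : ∀ x (G : Finset S₂), ∑ y ∈ G, lam (x, y) ≤ μ x)
    (h₂ : ∀ y (F : Finset S₁), ∑ x ∈ F, lam (x, y) ≤ ν y) : IsCouplingOf lam μ ν := by
  have s₁ (x : S₁) : Summable fun y => lam (x, y) :=
    summable_of_sum_le (fun y => hlam.1 (x, y)) (h₁ x)
  have s₂ (y : S₂) : Summable fun x => lam (x, y) :=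
    summable_of_sum_le (fun x => hlam.1 (x, y)) (h₂ y)
  -- The row sums are dominated by `μ` and have the same total mass, so they agree everywhere.
  have e₁ : (fun x => ∑' y, lam (x, y)) = μ :=
    eq_of_le_of_hasSum (fun x => (s₁ x).tsum_le_of_sum_le (h₁ x))
      (hlam.2.prod_fiberwise fun x => (s₁ x).hasSum) hμ
  have e₂ : (fun y => ∑' x, lam (x, y)) = ν :=
    eq_of_le_of_hasSum (fun y => (s₂ y).tsum_le_of_sum_le (h₂ y))
      (((Equiv.prodComm S₂ S₁).hasSum_iff.2 hlam.2).prod_fiberwise fun y => (s₂ y).hasSum) hν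
  exact ⟨hlam, fun x => congrFun e₁ x ▸ (s₁ x).hasSum, fun y => congrFun e₂ y ▸ (s₂ y).hasSum⟩

/-- The stochastic relation generated by `R` is closed under pointwise convergence of probability
vectors to probability vectors. -/
lemma mem_stochRel_of_tendsto {ι : Type*} {l : Filter ι} [l.NeBot] {m : ι → S₁ → ℝ}
    {n : ι → S₂ → ℝ} (h : ∀ᶠ i in l, (m i, n i) ∈ stochRel R)
    (hm : ∀ x, Tendsto (fun i => m i x) l (𝓝 (μ x)))
    (hn : ∀ y, Tendsto (fun i => n i y) l (𝓝 (ν y)))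
    (hμ : HasSum μ 1) (hν : HasSum ν 1) : (μ, ν) ∈ stochRel R := by
  classical
  have hex : ∀ i, ∃ lam : S₁ × S₂ → ℝ, (m i, n i) ∈ stochRel R →
      IsCouplingOf lam (m i) (n i) ∧ ∀ z ∉ R, lam z = 0 := fun i => by
    by_cases hi : (m i, n i) ∈ stochRel R
    · obtain ⟨lam, hl⟩ := mem_stochRel_iff.1 hi
      exact ⟨lam, fun _ => hl⟩
    · exact ⟨0, fun h => absurd h hi⟩
  choose lam hlam using hex
  -- Coupling weights lie in the compact interval $[0,1]$, so along an ultrafilter all coordinates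
  -- converge at once, without extracting subsequences.
  let U := Ultrafilter.of l
  have hU : (U : Filter ι) ≤ l := Ultrafilter.of_le l
  have hc : ∀ᶠ i in (U : Filter ι), IsCouplingOf (lam i) (m i) (n i) ∧ ∀ z ∉ R, lam i z = 0 :=
    (h.filter_mono hU).mono fun i hi => hlam i hi
  have hlim : ∀ z, ∃ a, Tendsto (fun i => lam i z) U (𝓝 a) := fun z => by
    obtain ⟨a, -, ha⟩ := (isCompact_Icc (a := (0 : ℝ)) (b := 1)).ultrafilter_le_nhds
      (U.map fun i => lam i z)
      (by
        rw [le_principal_iff, Ultrafilter.coe_map, mem_map]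
        filter_upwards [hc] with i hi using ⟨hi.1.1.1 z, hi.1.1.le_one z⟩)
    exact ⟨a, ha⟩
  choose L hL using hlim
  have hL0 : ∀ z, 0 ≤ L z := fun z =>
    ge_of_tendsto (hL z) (hc.mono fun i hi => hi.1.1.1 z)
  have hm' (x) := (hm x).mono_left hU
  have hn' (y) := (hn y).mono_left hU
  have hle : ∀ G : Finset (S₁ × S₂), ∑ z ∈ G, L z ≤ 1 := fun G =>
    le_of_tendsto (tendsto_finsetSum G fun z _ => hL z)
      (hc.mono fun i hi => sum_le_hasSum G (fun z _ => hi.1.1.1 z) hi.1.1.2)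
  have hsum : Summable L := summable_of_sum_le hL0 hle
  -- No mass escapes: the bound on `F ×ˢ G` passes to the limit, and its left side tends to one as
  -- `G` and then `F` exhaust the spaces.
  have hge : 1 ≤ ∑' z, L z := by
    have hFG (F : Finset S₁) (G : Finset S₂) :
        ∑ x ∈ F, μ x + ∑ y ∈ G, ν y - 1 ≤ ∑' z, L z :=
      (le_of_tendsto_of_tendsto
        (((tendsto_finsetSum F fun x _ => hm' x).add
          (tendsto_finsetSum G fun y _ => hn' y)).sub_const 1)
        (tendsto_finsetSum (F ×ˢ G) fun z _ => hL z)
        (hc.mono fun i hi => hi.1.add_sub_one_le F G)).trans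
        (hsum.sum_le_tsum _ fun z _ => hL0 z)
    have hF (F : Finset S₁) : ∑ x ∈ F, μ x + 1 - 1 ≤ ∑' z, L z :=
      le_of_tendsto' ((tendsto_const_nhds.add hν).sub_const 1) (hFG F)
    simpa using le_of_tendsto' ((hμ.add_const 1).sub_const 1) hF
  have hL1 : HasSum L 1 := by
    have := hsum.hasSum
    rwa [le_antisymm (hsum.tsum_le_of_sum_le hle) hge] at this
  -- Only inequalities for finite partial row and column sums pass directly to the limit; total mass
  -- one upgrades them to equalities.
  refine mem_stochRel_iff.2 ⟨L, isCouplingOf_of_sum_le ⟨hL0, hL1⟩ hμ hν (fun x G => ?_)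
    (fun y F => ?_), fun z hz => ?_⟩
  · exact le_of_tendsto_of_tendsto (tendsto_finsetSum G fun y _ => hL (x, y)) (hm' x)
      (hc.mono fun i hi => sum_le_hasSum G (fun y _ => hi.1.1.1 (x, y)) (hi.1.2.1 x))
  · exact le_of_tendsto_of_tendsto (tendsto_finsetSum F fun x _ => hL (x, y)) (hn' y)
      (hc.mono fun i hi => sum_le_hasSum F (fun x _ => hi.1.1.1 (x, y)) (hi.1.2.2 y))
  · exact tendsto_nhds_unique (hL z)
      (tendsto_const_nhds.congr' (hc.mono fun i hi => (hi.2 z hz).symm))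

end Couplings

/-! ### Monotonicity of $M$ and invariant subrelations. -/

section SubrelationMap

variable {S₁ S₂ : Type*} {Q₁ : S₁ → S₁ → ℝ} {Q₂ : S₂ → S₂ → ℝ} {R R' : Set (S₁ × S₂)}

lemma subrelMap_mono (h : R ⊆ R') : subrelMap Q₁ Q₂ R ⊆ subrelMap Q₁ Q₂ R' :=
  fun _ hp => ⟨h hp.1, stochRel_mono h hp.2⟩

lemma subset_subrelIter (h : R' ⊆ R) (hR' : R' ⊆ subrelMap Q₁ Q₂ R') (k : ℕ) :
    R' ⊆ subrelIter Q₁ Q₂ R k := by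
  induction k with
  | zero => exact h
  | succ k ih => exact hR'.trans (subrelMap_mono ih)

lemma subset_subrelLimit (h : R' ⊆ R) (hR' : R' ⊆ subrelMap Q₁ Q₂ R') :
    R' ⊆ subrelLimit Q₁ Q₂ R :=
  Set.subset_iInter (subset_subrelIter h hR')

lemma truncRel_subrelLimit_subset (A₁ : ℕ → Finset S₁) (A₂ : ℕ → Finset S₂) (n k : ℕ) :
    truncRel A₁ A₂ n (subrelLimit Q₁ Q₂ R) ⊆ truncRel A₁ A₂ n (subrelIter Q₁ Q₂ R k) :=
  Set.inter_subset_inter_left _ (Set.iInter_subset _ k)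

lemma eq_empty_of_truncRel_eq_empty {A₁ : ℕ → Finset S₁} {A₂ : ℕ → Finset S₂}
    (hA₁ : IsTruncationSeq Q₁ A₁) (hA₂ : IsTruncationSeq Q₂ A₂)
    (h : ∀ n, truncRel A₁ A₂ n R = ∅) : R = ∅ := by
  refine Set.eq_empty_of_forall_notMem fun ⟨x, y⟩ hxy => ?_
  obtain ⟨i, hi⟩ := Set.mem_iUnion.1 (hA₁.2.1.symm ▸ Set.mem_univ x)
  obtain ⟨j, hj⟩ := Set.mem_iUnion.1 (hA₂.2.1.symm ▸ Set.mem_univ y)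
  have : (x, y) ∈ truncRel A₁ A₂ (max i j) R :=
    ⟨hxy, hA₁.1 (le_max_left i j) hi, hA₂.1 (le_max_right i j) hj⟩
  rwa [h] at this

end SubrelationMap

/-! ### From transition probabilities to jump vectors as time tends to zero. -/

section Generator

lemma IsRateMatrix.hasSum {S : Type*} {Q : S → S → ℝ} (hQ : IsRateMatrix Q) (x : S) :
    HasSum (Q x) 0 := by
  classical
  have h1 : HasSum (fun y : ({x}ᶜ : Set S) => Q x y) (-Q x x) := hQ.2 x
  have h2 : HasSum (fun y : ({x} : Set S) => Q x y) (Q x x) := by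
    simpa using hasSum_unique fun y : ({x} : Set S) => Q x y
  simpa using h2.add_compl h1

lemma IsRateMatrix.diag_nonpos {S : Type*} {Q : S → S → ℝ} (hQ : IsRateMatrix Q) (x : S) :
    Q x x ≤ 0 :=
  neg_nonneg.1 ((hQ.2 x).nonneg fun y : {y : S // y ≠ x} => hQ.1 x y y.2.symm)

lemma hasSum_jumpVector {S : Type*} {Q : S → S → ℝ} (hQ : IsRateMatrix Q) (c : ℝ) (x : S) :
    HasSum (jumpVector Q c x) 1 := by
  have h := ((hQ.hasSum x).mul_left c⁻¹).add (hasSum_indicator_singleton x)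
  rwa [mul_zero, zero_add] at h

variable {Ω S : Type*} [MeasurableSpace Ω]

lemma MarkovProcess.dist_zero (X : MarkovProcess Ω S) (x y : S) :
    X.dist x 0 y = Set.indicator {x} (fun _ => (1 : ℝ)) y := by
  have := X.isProb x
  by_cases hy : y = x
  · have h : {ω | X.val 0 ω = y} =ᵐ[X.law x] Set.univ := by
      filter_upwards [X.start x] with ω hω
      exact propext ⟨fun _ => trivial, fun _ => hω.trans hy.symm⟩
    rw [MarkovProcess.dist, measureReal_congr h]
    simp [hy]
  · have h : {ω | X.val 0 ω = y} =ᵐ[X.law x] (∅ : Set Ω) := by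
      filter_upwards [X.start x] with ω hω
      exact propext ⟨fun h => hy (Eq.trans (Eq.symm h) hω), fun h => h.elim⟩
    rw [MarkovProcess.dist, measureReal_congr h]
    simp [hy]

lemma MarkovProcess.HasRateMatrix.tendsto {X : MarkovProcess Ω S} {Q : S → S → ℝ}
    (hQ : X.HasRateMatrix Q) (x y : S) :
    Tendsto (fun t : ℝ => t⁻¹ *
      (X.dist x t.toNNReal y - Set.indicator {x} (fun _ => (1 : ℝ)) y)) (𝓝[>] 0) (𝓝 (Q x y)) := by
  have h := (hasDerivWithinAt_iff_tendsto_slope' Set.self_notMem_Ioi).1 (hQ.2 x y).Ioi_of_Ici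
  refine h.congr fun t => ?_
  simp [slope_def_field, div_eq_inv_mul, X.dist_zero]

/-- A relation stochastically preserved by the processes is invariant under the subrelation map. -/
lemma StochPreserves.subset_subrelMap {Ω₁ Ω₂ S₁ S₂ : Type*} [MeasurableSpace Ω₁]
    [MeasurableSpace Ω₂] {X₁ : MarkovProcess Ω₁ S₁} {X₂ : MarkovProcess Ω₂ S₂}
    {Q₁ : S₁ → S₁ → ℝ} {Q₂ : S₂ → S₂ → ℝ} (hQ₁ : X₁.HasRateMatrix Q₁)
    (hQ₂ : X₂.HasRateMatrix Q₂) {R : Set (S₁ × S₂)} (hR : StochPreserves X₁ X₂ R) :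
    R ⊆ subrelMap Q₁ Q₂ R := by
  rintro ⟨x, y⟩ hxy
  refine ⟨hxy, ?_⟩
  set q := totalRate Q₁ Q₂ x y with hq
  have hx := hQ₁.1.diag_nonpos x
  have hy := hQ₂.1.diag_nonpos y
  have hq0 : 0 < q := by rw [hq, totalRate]; linarith
  -- The summand 1 in $q_{x,y}$ makes this strict, so the mass condition of `stochRel_affine` with
  -- $s=1/(qt)$, which holds strictly in the limit, holds for all small $t>0$.
  have hlt : q⁻¹ * (-Q₁ x x + -Q₂ y y) < 1 := by
    rw [inv_mul_lt_iff₀ hq0, hq, totalRate]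
    linarith
  have hlim := ((hQ₁.tendsto x x).neg.add (hQ₂.tendsto y y).neg).const_mul q⁻¹
  refine mem_stochRel_of_tendsto (l := 𝓝[>] (0 : ℝ)) ?_
    (fun u => ((hQ₁.tendsto x u).const_mul q⁻¹).add_const _)
    (fun v => ((hQ₂.tendsto y v).const_mul q⁻¹).add_const _)
    (hasSum_jumpVector hQ₁.1 q x) (hasSum_jumpVector hQ₂.1 q y)
  filter_upwards [hlim.eventually_lt_const hlt, self_mem_nhdsWithin] with t ht ht0
  have ht0 : 0 < t := ht0
  simp only [← mul_assoc]
  refine stochRel_affine (hR x y hxy t.toNNReal) hxy (by positivity) (le_trans (le_of_eq ?_) ht.le)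
  simp only [Set.mem_singleton_iff, Set.indicator_of_mem]
  ring

end Generator

theorem mainTheorem4 {S₁ S₂ Ω₁ Ω₂ : Type*} [Countable S₁] [Countable S₂]
    [MeasurableSpace Ω₁] [MeasurableSpace Ω₂]
    (X₁ : MarkovProcess Ω₁ S₁) (X₂ : MarkovProcess Ω₂ S₂)
    (Q₁ : S₁ → S₁ → ℝ) (Q₂ : S₂ → S₂ → ℝ)
    (hX₁ : X₁.Nonexplosive) (hX₂ : X₂.Nonexplosive)
    (hQ₁ : X₁.HasRateMatrix Q₁) (hQ₂ : X₂.HasRateMatrix Q₂)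
    (hJ₁ : LocallyBoundedJumps Q₁) (hJ₂ : LocallyBoundedJumps Q₂)
    (A₁ : ℕ → Finset S₁) (A₂ : ℕ → Finset S₂)
    (hA₁ : IsTruncationSeq Q₁ A₁) (hA₂ : IsTruncationSeq Q₂ A₂)
    (R : Set (S₁ × S₂)) :
    (∀ n, (∃ k, truncRel A₁ A₂ n (subrelIter Q₁ Q₂ R k) = ∅) →
      truncRel A₁ A₂ n (subrelLimit Q₁ Q₂ R) = ∅) ∧
    ((∀ n, ∃ k, truncRel A₁ A₂ n (subrelIter Q₁ Q₂ R k) = ∅) →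
      subrelLimit Q₁ Q₂ R = ∅ ∧
      ∀ R' : Set (S₁ × S₂), R' ⊆ R → R'.Nonempty → ¬ StochPreserves X₁ X₂ R') := by
  have h₁ : ∀ n, (∃ k, truncRel A₁ A₂ n (subrelIter Q₁ Q₂ R k) = ∅) →
      truncRel A₁ A₂ n (subrelLimit Q₁ Q₂ R) = ∅ := fun n ⟨k, hk⟩ =>
    Set.subset_eq_empty (truncRel_subrelLimit_subset A₁ A₂ n k) hk
  refine ⟨h₁, fun h => ?_⟩
  have h₂ : subrelLimit Q₁ Q₂ R = ∅ :=
    eq_empty_of_truncRel_eq_empty hA₁ hA₂ fun n => h₁ n (h n)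
  refine ⟨h₂, fun R' hR' hne hp => hne.ne_empty ?_⟩
  exact Set.subset_eq_empty (subset_subrelLimit hR' (hp.subset_subrelMap hQ₁ hQ₂)) h₂
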